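/- Let $\Gamma$ be a non-trivial (discrete) amenable group: for every finite $K\subseteq\Gamma$ and every $\delta>0$ there is a non-empty finite $F\subseteq\Gamma$ with $|KF\setminus F|\le\delta|F|$. Suppose that $\Gamma$ is of type FL, i.e. the trivial left $\mathbb{Z}\Gamma$-module $\mathbb{Z}$ has a finite resolution by finitely generated free modules $$0\to(\mathbb{Z}\Gamma)^{\oplus n_m}\to\cdots\to(\mathbb{Z}\Gamma)^{\oplus n_1}\to(\mathbb{Z}\Gamma)^{\oplus n_0}\to\mathbb{Z}\to 0.$$ Then the Euler characteristic of $\Gamma$ vanishes: for every such resolution, $\chi(\Gamma)=\sum_{i=0}^m(-1)^i n_i=0$. -/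

import Mathlib

open scoped Pointwise

/-- Amenability of a discrete group, by the (left) Følner condition: for every finite `K ⊆ Γ` and
every `δ > 0` there is a nonempty finite `F ⊆ Γ` with `|K F \ F| ≤ δ |F|`. -/
def IsAmenableGroup (Γ : Type*) [Group Γ] : Prop :=
  ∀ (K : Set Γ), K.Finite → ∀ δ : ℝ, 0 < δ →
    ∃ F : Set Γ, F.Finite ∧ F.Nonempty ∧ (((K * F) \ F).ncard : ℝ) ≤ δ * (F.ncard : ℝ)

/-- The integers as a module over the integral group ring `ℤΓ`, with trivial action of `Γ`. -/
abbrev TrivialIntModule (Γ : Type*) [Group Γ] : Type :=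
  (Representation.trivial ℤ Γ ℤ).asModule

/-- A finite resolution of the trivial left `ℤΓ`-module `ℤ` by finitely generated free modules,
`0 → (ℤΓ)^(n m) → ⋯ → (ℤΓ)^(n 1) → (ℤΓ)^(n 0) → ℤ → 0`.
The ranks and the differentials are indexed by all of `ℕ`, and the modules in degrees above the
length `m` are zero; exactness at degree `m` then says that the leftmost map is injective. -/
structure FiniteFreeResolution (Γ : Type*) [Group Γ] where
  /-- the length `m` -/
  length : ℕ
  /-- the ranks `n i` -/
  rank : ℕ → ℕ
  rank_eq_zero : ∀ i, length < i → rank i = 0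
  /-- the differentials -/
  d : ∀ i, (Fin (rank (i + 1)) → MonoidAlgebra ℤ Γ) →ₗ[MonoidAlgebra ℤ Γ]
    (Fin (rank i) → MonoidAlgebra ℤ Γ)
  /-- the augmentation -/
  ε : (Fin (rank 0) → MonoidAlgebra ℤ Γ) →ₗ[MonoidAlgebra ℤ Γ] TrivialIntModule Γ
  exact_d : ∀ i, Function.Exact (d (i + 1)) (d i)
  exact_ε : Function.Exact (d 0) ε
  surjective_ε : Function.Surjective ε

/-- A group is of type FL if it admits a finite free resolution. -/
def IsTypeFL (Γ : Type*) [Group Γ] : Prop :=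
  Nonempty (FiniteFreeResolution Γ)

/-- The alternating sum of the ranks of a finite free resolution. -/
def FiniteFreeResolution.eulerChar {Γ : Type*} [Group Γ] (C : FiniteFreeResolution Γ) : ℤ :=
  ∑ i ∈ Finset.range (C.length + 1), (-1) ^ i * (C.rank i : ℤ)

/-- The integer `χ` is the Euler characteristic of the group `Γ`: the group is of type FL and `χ`
is the alternating sum of the ranks of each of its finite free resolutions. -/
def IsEulerCharacteristic (Γ : Type*) [Group Γ] (χ : ℤ) : Prop :=
  IsTypeFL Γ ∧ ∀ C : FiniteFreeResolution Γ, C.eulerChar = χ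

/-!
Let `C` be a finite free resolution of `ℤ` over `ℤΓ` and `F` a finite subset of `Γ`. Inside each
`C i` consider the chains whose coefficients are supported on `F`; they form a free abelian group
of rank `n i * |F|`. The differentials are matrices over `ℤΓ`, so there is one finite symmetric
set `K` such that they enlarge supports from `F` to at most `F * K`
(`FiniteFreeResolution.exists_finite_forall_hasPropagation`).

The point is that the chains on `F` are exact up to an error of size `O(|(F * K) \ F|)`.
One direction is clear: boundaries of chains on `F` are cycles on `F * K`
(`HasPropagation.imageRank_le_kerRank`). For the other, a cycle on `F` is the boundary of a
chain `y` on which nothing is known, but the restriction of that boundary to `F` only sees the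
coefficients of `y` on `F * K`; hence the rank of the cycles on `F` is at most that of the
boundaries of chains on `F * K` (`HasPropagation.kerRank_le_imageRank`). Summing
rank–nullity over all degrees gives `|χ(Γ) * |F| - e| ≤ c * |(F * K) \ F|`, where `e ≤ 1` is the
rank of the image of the augmentation on chains on `F` and `c` does not depend on `F`
(`FiniteFreeResolution.exists_abs_eulerChar_mul_ncard_sub_augRank_le`).

If `Γ` is finite, `F = Γ` has no boundary and `χ(Γ) * |Γ| = 1`, so `Γ` is trivial. If `Γ` is
infinite and amenable, there are Følner sets `F` with `1 + c * |(F * K) \ F| < |F|`, and the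
integer `χ(Γ)` is `0`. There is no need to pass to a field of coefficients, since rank–nullity
holds over any domain.
-/

open scoped Pointwise

/-! ### Ranks of submodules -/

/-- Rank–nullity for the restriction of a linear map to a finitely generated submodule. -/
theorem finrank_eq_finrank_map_add_finrank_ker_inf {R M N : Type*} [CommRing R] [IsDomain R]
    [AddCommGroup M] [Module R M] [AddCommGroup N] [Module R N] (f : M →ₗ[R] N)
    (S : Submodule R M) [Module.Finite R S] :
    Module.finrank R S =
      Module.finrank R (S.map f) + Module.finrank R (LinearMap.ker f ⊓ S : Submodule R M) := by
  have h := Submodule.finrank_quotient_add_finrank (LinearMap.ker (f.domRestrict S))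
  rw [(LinearMap.quotKerEquivRange _).finrank_eq, LinearMap.range_domRestrict,
    LinearMap.ker_domRestrict] at h
  rw [← h, inf_comm, ← Submodule.map_comap_subtype]
  congr 1
  exact (Submodule.equivMapOfInjective _ S.injective_subtype _).finrank_eq

/-! ### Chains supported on a set of group elements -/

section Chains

variable {R : Type*} [CommRing R] {Γ : Type*}

variable (R) in
/-- The `R`-submodule of `(RΓ)ⁿ` of the elements all of whose coordinates are supported
on `F`. -/
def chainsOn (n : ℕ) (F : Set Γ) : Submodule R (Fin n → MonoidAlgebra R Γ) where
  carrier := {x | ∀ i, ∀ g ∉ F, (x i).coeff g = 0}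
  zero_mem' := by simp
  add_mem' := by
    intro x y hx hy i g hg
    simp [hx i g hg, hy i g hg]
  smul_mem' := by
    intro c x hx i g hg
    simp [hx i g hg]

theorem chainsOn_mono {n : ℕ} {F G : Set Γ} (h : F ⊆ G) : chainsOn R n F ≤ chainsOn R n G :=
  fun _ hx i g hg => hx i g fun hF => hg (h hF)

variable (R) in
@[simp]
theorem chainsOn_univ (n : ℕ) : chainsOn R n (Set.univ : Set Γ) = ⊤ :=
  eq_top_iff.2 fun _ _ _ g hg => (hg (Set.mem_univ g)).elim

open Classical in
variable (R) in
/-- The projection of `(RΓ)ⁿ` onto the elements supported on `F` that forgets all coefficients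
outside `F`. -/
noncomputable def restrictTo (n : ℕ) (F : Set Γ) :
    (Fin n → MonoidAlgebra R Γ) →ₗ[R] (Fin n → MonoidAlgebra R Γ) where
  toFun x i := .ofCoeff ((x i).coeff.filter (· ∈ F))
  map_add' x y := by
    ext i g
    by_cases h : g ∈ F <;> simp [h]
  map_smul' c x := by
    ext i g
    by_cases h : g ∈ F <;> simp [h]

open Classical in
theorem coeff_restrictTo {n : ℕ} (F : Set Γ) (x : Fin n → MonoidAlgebra R Γ) (i : Fin n) (g : Γ) :
    (restrictTo R n F x i).coeff g = if g ∈ F then (x i).coeff g else 0 := by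
  simp [restrictTo, MonoidAlgebra.coeff_ofCoeff, Finsupp.filter_apply]

theorem restrictTo_mem {n : ℕ} (F : Set Γ) (x : Fin n → MonoidAlgebra R Γ) :
    restrictTo R n F x ∈ chainsOn R n F := by
  intro i g hg
  simp [coeff_restrictTo, hg]

theorem sub_restrictTo_mem {n : ℕ} (F : Set Γ) (x : Fin n → MonoidAlgebra R Γ) :
    x - restrictTo R n F x ∈ chainsOn R n Fᶜ := by
  intro i g hg
  have hg : g ∈ F := not_not.1 hg
  simp [coeff_restrictTo, hg]

theorem restrictTo_eq_self {n : ℕ} {F : Set Γ} {x : Fin n → MonoidAlgebra R Γ}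
    (hx : x ∈ chainsOn R n F) : restrictTo R n F x = x := by
  ext i g
  by_cases hg : g ∈ F
  · simp [coeff_restrictTo, hg]
  · simp [coeff_restrictTo, hg, hx i g hg]

theorem restrictTo_eq_zero_iff {n : ℕ} {F : Set Γ} {x : Fin n → MonoidAlgebra R Γ} :
    restrictTo R n F x = 0 ↔ x ∈ chainsOn R n Fᶜ := by
  constructor
  · intro h
    simpa [h] using sub_restrictTo_mem F x
  · intro hx
    ext i g
    by_cases hg : g ∈ F
    · simp [coeff_restrictTo, hg, hx i g (not_not.2 hg)]
    · simp [coeff_restrictTo, hg]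

variable (R) in
/-- An element of `(RΓ)ⁿ` supported on `F` is given by its `n * |F|` coefficients. -/
noncomputable def chainsOnEquiv (n : ℕ) (F : Set Γ) :
    chainsOn R n F ≃ₗ[R] (Fin n → (F →₀ R)) where
  toFun x i := (x.1 i).coeff.subtypeDomain (· ∈ F)
  invFun y := ⟨fun i => .ofCoeff ((y i).embDomain (Function.Embedding.subtype (· ∈ F))), by
    intro i g hg
    rw [MonoidAlgebra.coeff_ofCoeff]
    refine Finsupp.embDomain_of_notMem_range _ _ _ ?_
    rintro ⟨a, rfl⟩
    exact hg a.2⟩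
  left_inv x := by
    ext i g
    rw [MonoidAlgebra.coeff_ofCoeff]
    by_cases hg : g ∈ F
    · exact Finsupp.embDomain_apply_self (Function.Embedding.subtype (· ∈ F)) _ ⟨g, hg⟩
    · rw [x.2 i g hg]
      refine Finsupp.embDomain_of_notMem_range _ _ _ ?_
      rintro ⟨a, rfl⟩
      exact hg a.2
  right_inv y := by
    ext i g
    exact Finsupp.embDomain_apply_self (Function.Embedding.subtype (· ∈ F)) _ g
  map_add' x y := by
    ext i g
    simp
  map_smul' c x := by
    ext i g
    simp

variable (R) in
theorem module_finite_chainsOn (n : ℕ) {F : Set Γ} (hF : F.Finite) :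
    Module.Finite R (chainsOn R n F) := by
  have := hF.to_subtype
  exact Module.Finite.equiv (chainsOnEquiv R n F).symm

variable (R) in
theorem finrank_chainsOn [Nontrivial R] (n : ℕ) {F : Set Γ} (hF : F.Finite) :
    Module.finrank R (chainsOn R n F) = n * F.ncard := by
  have := hF.fintype
  rw [(chainsOnEquiv R n F).finrank_eq, Module.finrank_pi_fintype]
  simp

theorem module_finite_of_le_chainsOn [IsNoetherianRing R] {n : ℕ} {F : Set Γ} (hF : F.Finite)
    {S : Submodule R (Fin n → MonoidAlgebra R Γ)} (h : S ≤ chainsOn R n F) : Module.Finite R S := by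
  have := module_finite_chainsOn R n hF
  have := isNoetherian_of_isNoetherianRing_of_finite R (chainsOn R n F)
  have := isNoetherian_of_le h
  infer_instance

variable {n : ℕ} {N : Type*} [AddCommGroup N] [Module R N]

/-- The rank of the image under `f` of the elements supported on `F`. -/
noncomputable def imageRank (f : (Fin n → MonoidAlgebra R Γ) →ₗ[R] N) (F : Set Γ) : ℕ :=
  Module.finrank R ((chainsOn R n F).map f)

/-- The rank of the submodule of those elements of the kernel of `f` that are supported on `F`. -/
noncomputable def kerRank (f : (Fin n → MonoidAlgebra R Γ) →ₗ[R] N) (F : Set Γ) : ℕ :=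
  Module.finrank R (LinearMap.ker f ⊓ chainsOn R n F : Submodule R (Fin n → MonoidAlgebra R Γ))

theorem imageRank_le_finrank [Nontrivial R] [Module.Finite R N]
    (f : (Fin n → MonoidAlgebra R Γ) →ₗ[R] N) (F : Set Γ) :
    imageRank f F ≤ Module.finrank R N :=
  Submodule.finrank_le _

theorem imageRank_univ_of_surjective {f : (Fin n → MonoidAlgebra R Γ) →ₗ[R] N}
    (hf : Function.Surjective f) : imageRank f (Set.univ : Set Γ) = Module.finrank R N := by
  rw [imageRank, chainsOn_univ, Submodule.map_top, LinearMap.range_eq_top.2 hf, finrank_top]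

variable [IsDomain R]

theorem mul_ncard_eq_imageRank_add_kerRank
    (f : (Fin n → MonoidAlgebra R Γ) →ₗ[R] N) {F : Set Γ} (hF : F.Finite) :
    n * F.ncard = imageRank f F + kerRank f F := by
  have := module_finite_chainsOn R n hF
  rw [← finrank_chainsOn R n hF, finrank_eq_finrank_map_add_finrank_ker_inf f, imageRank, kerRank]

variable [IsNoetherianRing R]

/-- Enlarging the support set from `G ∩ F` to `G` enlarges the kernel by at most the number of new
coefficients: the map to the coefficients on `G \ F` has the elements supported on `G ∩ F` as
its kernel. -/
theorem kerRank_le (f : (Fin n → MonoidAlgebra R Γ) →ₗ[R] N) (F : Set Γ)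
    {G : Set Γ} (hG : G.Finite) :
    kerRank f G ≤ kerRank f (G ∩ F) + n * (G \ F).ncard := by
  have := module_finite_of_le_chainsOn hG
    (inf_le_right : LinearMap.ker f ⊓ chainsOn R n G ≤ chainsOn R n G)
  have := module_finite_of_le_chainsOn (hG.inter_of_left F)
    (inf_le_right : LinearMap.ker f ⊓ chainsOn R n (G ∩ F) ≤ chainsOn R n (G ∩ F))
  have := module_finite_chainsOn R n (hG.sdiff (t := F))
  rw [kerRank, finrank_eq_finrank_map_add_finrank_ker_inf (restrictTo R n (G \ F)), add_comm,
    ← finrank_chainsOn R n hG.sdiff]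
  refine add_le_add (Submodule.finrank_mono ?_) (Submodule.finrank_mono ?_)
  · rintro x ⟨hx, hxf, hxG⟩
    refine ⟨hxf, fun i g hg => ?_⟩
    have hx := restrictTo_eq_zero_iff.1 (LinearMap.mem_ker.1 hx)
    by_cases hgG : g ∈ G
    · exact hx i g fun h => h ⟨hgG, fun hgF => hg ⟨hgG, hgF⟩⟩
    · exact hxG i g hgG
  · rintro _ ⟨x, -, rfl⟩
    exact restrictTo_mem _ _

theorem imageRank_le (f : (Fin n → MonoidAlgebra R Γ) →ₗ[R] N) {F G : Set Γ}
    (hFG : F ⊆ G) (hG : G.Finite) :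
    imageRank f G ≤ imageRank f F + n * (G \ F).ncard := by
  have := module_finite_of_le_chainsOn hG
    (inf_le_right : LinearMap.ker f ⊓ chainsOn R n G ≤ chainsOn R n G)
  have hker : kerRank f F ≤ kerRank f G :=
    Submodule.finrank_mono (inf_le_inf_left _ (chainsOn_mono hFG))
  have hFrank := mul_ncard_eq_imageRank_add_kerRank f (hG.subset hFG)
  have hGrank := mul_ncard_eq_imageRank_add_kerRank f hG
  rw [← Set.ncard_sdiff_add_ncard_of_subset hFG hG, mul_add] at hGrank
  omega

end Chains

/-! ### Maps of finite propagation -/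

section Propagation

variable {R : Type*} [CommRing R] {Γ : Type*} [Group Γ] {p q : ℕ}

/-- The `R`-linear map `f` has propagation in `K` if the image of an element supported on `F` is
supported on `F * K`. -/
def HasPropagation (f : (Fin p → MonoidAlgebra R Γ) →ₗ[R] (Fin q → MonoidAlgebra R Γ))
    (K : Set Γ) : Prop :=
  ∀ (F : Set Γ), ∀ x ∈ chainsOn R p F, f x ∈ chainsOn R q (F * K)

theorem HasPropagation.mono
    {f : (Fin p → MonoidAlgebra R Γ) →ₗ[R] (Fin q → MonoidAlgebra R Γ)} {K L : Set Γ}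
    (h : HasPropagation f K) (hKL : K ⊆ L) : HasPropagation f L :=
  fun F x hx => chainsOn_mono (Set.mul_subset_mul_left hKL) (h F x hx)

/-- An `RΓ`-linear map is right multiplication by a matrix over `RΓ`, so it has propagation in the
finite set of group elements that occur in the entries of the matrix. -/
theorem exists_finite_hasPropagation
    (f : (Fin p → MonoidAlgebra R Γ) →ₗ[MonoidAlgebra R Γ] (Fin q → MonoidAlgebra R Γ)) :
    ∃ K : Set Γ, K.Finite ∧ HasPropagation (f.restrictScalars R) K := by
  classical
  refine ⟨⋃ i, ⋃ j, ((f (Pi.single i 1) j).coeff.support : Set Γ),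
    Set.finite_iUnion fun i => Set.finite_iUnion fun j => Finset.finite_toSet _, ?_⟩
  intro F x hx j g hg
  have hfx : f x = ∑ i, x i • f (Pi.single i 1) := by
    conv_lhs => rw [pi_eq_sum_univ' x]
    rw [map_sum]
    refine Finset.sum_congr rfl fun i _ => ?_
    rw [← map_smul]
  rw [LinearMap.restrictScalars_apply, hfx, Finset.sum_apply, MonoidAlgebra.coeff_sum,
    Finsupp.finsetSum_apply]
  refine Finset.sum_eq_zero fun i _ => ?_
  by_contra hne
  rw [Pi.smul_apply, smul_eq_mul] at hne
  obtain ⟨a, ha, b, hb, rfl⟩ := Finset.mem_mul.1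
    (MonoidAlgebra.support_coeff_mul_subset _ _ (Finsupp.mem_support_iff.2 hne))
  refine hg (Set.mul_mem_mul ?_ (Set.mem_iUnion.2 ⟨i, Set.mem_iUnion.2 ⟨j, hb⟩⟩))
  by_contra haF
  exact Finsupp.mem_support_iff.1 ha (hx i a haF)

variable [IsDomain R] [IsNoetherianRing R]
  {f : (Fin p → MonoidAlgebra R Γ) →ₗ[R] (Fin q → MonoidAlgebra R Γ)}
  {N : Type*} [AddCommGroup N] [Module R N] {g : (Fin q → MonoidAlgebra R Γ) →ₗ[R] N}
  {K F : Set Γ}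

/-- Boundaries of chains on `F` are cycles on `F * K`, and these are cycles on `F` up to the
coefficients on `(F * K) \ F`. -/
theorem HasPropagation.imageRank_le_kerRank (hf : HasPropagation f K)
    (hfg : Function.Exact f g) (hK : K.Finite) (hone : 1 ∈ K) (hF : F.Finite) :
    imageRank f F ≤ kerRank g F + q * ((F * K) \ F).ncard := by
  have hFK : F ⊆ F * K := Set.subset_mul_left F hone
  have := module_finite_of_le_chainsOn (hF.mul hK)
    (inf_le_right : LinearMap.ker g ⊓ chainsOn R q (F * K) ≤ chainsOn R q (F * K))
  have h := kerRank_le g F (hF.mul hK)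
  rw [Set.inter_eq_right.2 hFK] at h
  refine (Submodule.finrank_mono ?_).trans h
  rintro _ ⟨x, hx, rfl⟩
  exact ⟨(hfg (f x)).2 ⟨x, rfl⟩, hf F x hx⟩

/-- A cycle on `F` is the boundary of some chain `y`, whose support is not under control. But on
`F` the boundary of `y` depends on the coefficients of `y` on `F * K` only, so the cycles on `F`
embed into the restrictions to `F` of boundaries of chains on `F * K`. -/
theorem HasPropagation.kerRank_le_imageRank (hf : HasPropagation f K)
    (hfg : Function.Exact f g) (hK : K.Finite) (hone : 1 ∈ K) (hinv : ∀ k ∈ K, k⁻¹ ∈ K)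
    (hF : F.Finite) :
    kerRank g F ≤ imageRank f F + p * ((F * K) \ F).ncard := by
  have := module_finite_chainsOn R p (hF.mul hK)
  have : Module.Finite R ((chainsOn R p (F * K)).map f) := Module.Finite.map _ _
  refine le_trans ?_ (imageRank_le f (Set.subset_mul_left F hone) (hF.mul hK))
  refine le_trans (Submodule.finrank_mono ?_) (Submodule.finrank_map_le (restrictTo R q F) _)
  rintro x ⟨hxg, hxF⟩
  obtain ⟨y, rfl⟩ := (hfg x).1 hxg
  refine ⟨f (restrictTo R p (F * K) y), ⟨_, restrictTo_mem _ _, rfl⟩, ?_⟩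
  have hout : f (y - restrictTo R p (F * K) y) ∈ chainsOn R q Fᶜ := by
    refine chainsOn_mono ?_ (hf _ _ (sub_restrictTo_mem (F * K) y))
    rintro _ ⟨a, ha, k, hk, rfl⟩ hmem
    exact ha ⟨a * k, hmem, k⁻¹, hinv k hk, by simp⟩
  rw [← restrictTo_eq_zero_iff, map_sub, map_sub, sub_eq_zero] at hout
  rw [← hout, restrictTo_eq_self hxF]

theorem HasPropagation.abs_kerRank_sub_imageRank_le (hf : HasPropagation f K)
    (hfg : Function.Exact f g) (hK : K.Finite) (hone : 1 ∈ K) (hinv : ∀ k ∈ K, k⁻¹ ∈ K)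
    (hF : F.Finite) :
    |(kerRank g F : ℤ) - imageRank f F| ≤ ((p + q : ℕ) : ℤ) * ((F * K) \ F).ncard := by
  have h₁ := hf.imageRank_le_kerRank hfg hK hone hF
  have h₂ := hf.kerRank_le_imageRank hfg hK hone hinv hF
  have h₃ : (p + q) * ((F * K) \ F).ncard =
      p * ((F * K) \ F).ncard + q * ((F * K) \ F).ncard := add_mul _ _ _
  have h₄ : (0 : ℤ) ≤ p * ((F * K) \ F).ncard := by positivity
  have h₅ : (0 : ℤ) ≤ q * ((F * K) \ F).ncard := by positivity
  zify at h₁ h₂ h₃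
  push_cast
  rw [abs_le]
  constructor <;> linarith

end Propagation

/-! ### Counting ranks along a resolution -/

theorem sum_range_alternating_eq (a z r : ℕ → ℤ) (e : ℤ) (h₀ : a 0 = e + z 0)
    (hsucc : ∀ i, a (i + 1) = r i + z (i + 1)) (m : ℕ) :
    ∑ i ∈ Finset.range (m + 1), (-1) ^ i * a i =
      e + ∑ i ∈ Finset.range (m + 1), (-1) ^ i * (z i - r i) + (-1) ^ m * r m := by
  induction m with
  | zero =>
    simp only [zero_add, Finset.sum_range_one, pow_zero, one_mul, h₀]
    ring
  | succ m ih =>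
    rw [Finset.sum_range_succ, ih, Finset.sum_range_succ _ (m + 1), hsucc, pow_succ]
    ring

namespace FiniteFreeResolution

variable {Γ : Type*} [Group Γ] (C : FiniteFreeResolution Γ)

/-- The rank of the image under the augmentation of the chains of degree `0` supported
on `F`. -/
noncomputable def augRank (F : Set Γ) : ℕ :=
  imageRank (C.ε.restrictScalars ℤ) F

theorem finrank_trivialIntModule : Module.finrank ℤ (TrivialIntModule Γ) = 1 :=
  (LinearEquiv.finrank_eq (Representation.trivial ℤ Γ ℤ).asModuleEquiv).trans
    (Module.finrank_self ℤ)

theorem augRank_le_one (F : Set Γ) : C.augRank F ≤ 1 :=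
  have : Module.Finite ℤ (TrivialIntModule Γ) :=
    .equiv (Representation.trivial ℤ Γ ℤ).asModuleEquiv.symm
  (imageRank_le_finrank _ F).trans finrank_trivialIntModule.le

theorem augRank_univ : C.augRank Set.univ = 1 :=
  (imageRank_univ_of_surjective C.surjective_ε).trans finrank_trivialIntModule

theorem exists_finite_forall_hasPropagation :
    ∃ K : Set Γ, K.Finite ∧ 1 ∈ K ∧ (∀ k ∈ K, k⁻¹ ∈ K) ∧
      ∀ i ≤ C.length, HasPropagation ((C.d i).restrictScalars ℤ) K := by
  choose L hL hprop using fun i => exists_finite_hasPropagation (C.d i)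
  have hU : (⋃ i ∈ Finset.range (C.length + 1), L i).Finite :=
    Set.Finite.biUnion (Finset.finite_toSet _) fun i _ => hL i
  refine ⟨{1} ∪ ((⋃ i ∈ Finset.range (C.length + 1), L i) ∪
    (⋃ i ∈ Finset.range (C.length + 1), L i)⁻¹),
    (Set.finite_singleton 1).union (hU.union hU.inv), by simp, ?_, fun i hi => ?_⟩
  · rintro k (hk | hk | hk)
    · exact Or.inl (by simpa using hk)
    · exact Or.inr (Or.inr (by simpa using hk))
    · exact Or.inr (Or.inl hk)
  · refine (hprop i).mono fun k hk => Or.inr (Or.inl ?_)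
    exact Set.mem_biUnion (Finset.mem_coe.2 (Finset.mem_range.2 (by omega))) hk

/-- On the chains supported on a finite set `F`, exactness fails by at most a multiple of the
size of the boundary `(F * K) \ F`, so the Euler–Poincaré count holds up to that error. -/
theorem exists_abs_eulerChar_mul_ncard_sub_augRank_le :
    ∃ (K : Set Γ) (c : ℕ), K.Finite ∧ (∀ k ∈ K, k⁻¹ ∈ K) ∧ ∀ F : Set Γ, F.Finite →
      |C.eulerChar * F.ncard - C.augRank F| ≤ c * ((F * K) \ F).ncard := by
  obtain ⟨K, hK, hone, hinv, hprop⟩ := C.exists_finite_forall_hasPropagation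
  refine ⟨K, ∑ i ∈ Finset.range (C.length + 1), (C.rank (i + 1) + C.rank i), hK, hinv,
    fun F hF => ?_⟩
  -- `r i` is the rank of the boundaries of chains on `F`, `z i` that of the cycles on `F`;
  -- in degree `0` a cycle is an element of the kernel of the augmentation.
  let r : ℕ → ℤ := fun i => imageRank ((C.d i).restrictScalars ℤ) F
  let z : ℕ → ℤ := fun i => match i with
    | 0 => kerRank (C.ε.restrictScalars ℤ) F
    | j + 1 => kerRank ((C.d j).restrictScalars ℤ) F
  have hzr : ∀ i ≤ C.length,
      |z i - r i| ≤ ((C.rank (i + 1) + C.rank i : ℕ) : ℤ) * ((F * K) \ F).ncard := by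
    intro i hi
    cases i with
    | zero =>
      exact (hprop 0 hi).abs_kerRank_sub_imageRank_le
        (g := C.ε.restrictScalars ℤ) C.exact_ε hK hone hinv hF
    | succ j =>
      exact (hprop (j + 1) hi).abs_kerRank_sub_imageRank_le
        (g := (C.d j).restrictScalars ℤ) (C.exact_d j) hK hone hinv hF
  -- There are no boundaries in the top degree.
  have hr_top : r C.length = 0 := by
    have h := mul_ncard_eq_imageRank_add_kerRank
      ((C.d C.length).restrictScalars ℤ) hF
    have hle : imageRank ((C.d C.length).restrictScalars ℤ) F ≤
        C.rank (C.length + 1) * F.ncard := h ▸ Nat.le_add_right _ _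
    have hzero : C.rank (C.length + 1) * F.ncard = 0 := by
      rw [C.rank_eq_zero _ (Nat.lt_succ_self _), zero_mul]
    exact congrArg Nat.cast (Nat.le_zero.1 (hle.trans_eq hzero))
  have hcount := sum_range_alternating_eq (fun i => (C.rank i : ℤ) * F.ncard) z r (C.augRank F)
    (by
      rw [← Nat.cast_mul, mul_ncard_eq_imageRank_add_kerRank (C.ε.restrictScalars ℤ) hF,
        Nat.cast_add]
      rfl)
    (fun i => by
      rw [← Nat.cast_mul, mul_ncard_eq_imageRank_add_kerRank ((C.d i).restrictScalars ℤ) hF,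
        Nat.cast_add])
    C.length
  have hchi : C.eulerChar * F.ncard =
      ∑ i ∈ Finset.range (C.length + 1), (-1) ^ i * ((C.rank i : ℤ) * F.ncard) := by
    rw [eulerChar, Finset.sum_mul]
    exact Finset.sum_congr rfl fun i _ => mul_assoc _ _ _
  rw [hchi, hcount, hr_top, mul_zero, add_zero, add_sub_cancel_left, Nat.cast_sum,
    Finset.sum_mul]
  refine (Finset.abs_sum_le_sum_abs _ _).trans (Finset.sum_le_sum fun i hi => ?_)
  rw [abs_mul, abs_pow, abs_neg, abs_one, one_pow, one_mul]
  exact hzr i (Nat.lt_succ_iff.1 (Finset.mem_range.1 hi))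

/-! ### The Euler characteristic -/

/-- For `F = Γ` there is no boundary, and the count is the identity `χ(Γ) * |Γ| = 1`. -/
theorem eulerChar_mul_card_of_finite [Finite Γ] : C.eulerChar * Nat.card Γ = 1 := by
  obtain ⟨K, c, -, -, h⟩ := C.exists_abs_eulerChar_mul_ncard_sub_augRank_le
  have h := h Set.univ Set.finite_univ
  rw [Set.sdiff_univ, Set.ncard_empty, augRank_univ, Set.ncard_univ] at h
  simpa [sub_eq_zero] using h

/-- In an infinite amenable group the Følner sets can be taken so large, with so small a boundary,
that the error terms are less than `|F|`. -/
theorem eulerChar_eq_zero_of_infinite [Infinite Γ] (hΓ : IsAmenableGroup Γ) :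
    C.eulerChar = 0 := by
  obtain ⟨K, c, hK, hinv, h⟩ := C.exists_abs_eulerChar_mul_ncard_sub_augRank_le
  obtain ⟨T, hT⟩ := Infinite.exists_subset_card_eq Γ 4
  have hL : (K ∪ T).Finite := hK.union T.finite_toSet
  obtain ⟨F, hF, ⟨a, ha⟩, hδ⟩ := hΓ (K ∪ T) hL (1 / (3 * (c + 1))) (by positivity)
  have hbd : ((c : ℝ) + 1) * (((K ∪ T) * F) \ F).ncard ≤ F.ncard / 3 := by
    calc ((c : ℝ) + 1) * (((K ∪ T) * F) \ F).ncard
        ≤ (c + 1) * (1 / (3 * (c + 1)) * F.ncard) := by gcongr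
      _ = F.ncard / 3 := by field_simp
  have hbd : 3 * ((c + 1) * (((K ∪ T) * F) \ F).ncard) ≤ F.ncard := by
    have : (3 : ℝ) * ((c + 1) * (((K ∪ T) * F) \ F).ncard) ≤ F.ncard := by linarith
    exact_mod_cast this
  -- The translate `T * {a}` lies in `(K ∪ T) * F`, which is hardly larger than `F`.
  have hcard : 4 ≤ F.ncard + (((K ∪ T) * F) \ F).ncard := by
    calc 4 = ((T : Set Γ) * {a}).ncard := by
          rw [Set.mul_singleton, Set.ncard_image_of_injective _ (mul_left_injective a),
            Set.ncard_coe_finset, hT]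
      _ ≤ (F ∪ (((K ∪ T) * F) \ F)).ncard := by
          refine Set.ncard_le_ncard ?_ (hF.union (hL.mul hF).sdiff)
          rw [Set.union_sdiff_self]
          exact (Set.mul_subset_mul Set.subset_union_right
            (Set.singleton_subset_iff.2 ha)).trans Set.subset_union_right
      _ ≤ _ := Set.ncard_union_le _ _
  -- Chains are moved by multiplication from the right, so the count is applied to `F⁻¹`.
  have hinvbd : ((F⁻¹ * K) \ F⁻¹).ncard ≤ (((K ∪ T) * F) \ F).ncard := by
    rw [← Set.ncard_image_of_injective _ (inv_injective (G := Γ))]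
    refine Set.ncard_le_ncard ?_ (hL.mul hF).sdiff
    rintro _ ⟨_, ⟨⟨b, hb, k, hk, rfl⟩, hbk⟩, rfl⟩
    refine ⟨⟨k⁻¹, Or.inl (hinv k hk), b⁻¹, hb, by simp⟩, hbk⟩
  have hest := h F⁻¹ hF.inv
  have hncard : (F⁻¹).ncard = F.ncard := by
    rw [← Set.image_inv_eq_inv, Set.ncard_image_of_injective _ inv_injective]
  rw [hncard] at hest
  have haug := C.augRank_le_one F⁻¹
  have hcb : c * ((F⁻¹ * K) \ F⁻¹).ncard ≤ c * (((K ∪ T) * F) \ F).ncard :=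
    Nat.mul_le_mul_left _ hinvbd
  rw [add_one_mul] at hbd
  by_contra hne
  have hone : (F.ncard : ℤ) ≤ |C.eulerChar * F.ncard| := by
    rw [abs_mul, Nat.abs_cast]
    exact le_mul_of_one_le_left (by positivity) (Int.one_le_abs hne)
  have htri := abs_sub_abs_le_abs_sub (C.eulerChar * F.ncard) (C.augRank F⁻¹)
  rw [Nat.abs_cast] at htri
  zify at hbd hcard haug hcb
  -- `3 * |F| ≤ 3 * (1 + c * |∂F|) ≤ 3 + |F|` contradicts `4 ≤ |F| + |∂F|` and `3 * |∂F| ≤ |F|`.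
  have hc : (0 : ℤ) ≤ c * (((K ∪ T) * F) \ F).ncard := by positivity
  have hb : (0 : ℤ) ≤ (((K ∪ T) * F) \ F).ncard := by positivity
  omega

end FiniteFreeResolution

theorem proposition8p1 {Γ : Type*} [Group Γ] [Nontrivial Γ]
    (hamenable : IsAmenableGroup Γ) (hFL : IsTypeFL Γ) :
    IsEulerCharacteristic Γ 0 := by
  refine ⟨hFL, fun C => ?_⟩
  cases finite_or_infinite Γ with
  | inl _ =>
    have h := C.eulerChar_mul_card_of_finite
    have hcard : Nat.card Γ = 1 := by
      exact_mod_cast Int.eq_one_of_dvd_one (by positivity) (Dvd.intro_left _ h)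
    exact absurd hcard Finite.one_lt_card.ne'
  | inr _ => exact C.eulerChar_eq_zero_of_infinite hamenable
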